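/- Let $n \ge 1$ be an integer, let $\gamma \in (0,1)$, $\tau > 0$ and $\rho \ge 0$ be real numbers, and let $\bar Y$ be a real symmetric positive definite $n \times n$ matrix. For symmetric matrices, write $A \preceq B$ (or $B \succeq A$) if $B - A$ is positive semidefinite. Let $X$ be a random real symmetric $n \times n$ matrix such that \[ 0 \preceq X \preceq \rho \bar Y \ \text{ almost surely, and } \ \tau \bar Y \preceq \mathbb{E}[X]. \] Let $T$ be an integer with \[ T \ge \left\lceil \frac{4\rho}{\gamma^2 \tau} \log(2n) \right\rceil , \] where $\log$ is the natural logarithm, and let $X_1, \dots, X_T$ be independent random matrices, each with the same distribution as $X$. Then, with probability at least $1 - \frac{1}{2n}$, \[ \frac{1}{T} \sum_{t=1}^{T} X_t \succeq (1-\gamma)\, \tau\, \bar Y . \] -/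

import Mathlib

open MeasureTheory ProbabilityTheory
open scoped MatrixOrder

/-- The product (equivalently, Borel) σ-algebra on the finite-dimensional space of real
`n × n` matrices. -/
instance matrixMeasurableSpace (n : ℕ) : MeasurableSpace (Matrix (Fin n) (Fin n) ℝ) :=
  inferInstanceAs (MeasurableSpace (Fin n → Fin n → ℝ))

/-- The entrywise expectation `𝔼[X]` of a random real matrix `X`. -/
noncomputable def matrixExpectation {Ω : Type*} [MeasurableSpace Ω] {n : ℕ}
    (X : Ω → Matrix (Fin n) (Fin n) ℝ) (P : Measure Ω) : Matrix (Fin n) (Fin n) ℝ :=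
  Matrix.of fun i j => ∫ ω, X ω i j ∂P

/-!
The statement is the lower tail of the matrix Chernoff bound, proved by the Laplace transform method
of Ahlswede and Winter.

Write `ρ Y = Cᴴ C` and conjugate by `C⁻¹`: this preserves the Loewner order, so one may assume
`0 ≤ Z ≤ 1` and `(τ / ρ) • 1 ≤ 𝔼[Z]` for `Z = C⁻ᴴ X C⁻¹`. If the sum `S` of `N` independent copies
of `Z` fails to dominate `a • 1`, some eigenvalue of `S` lies below `a`, hence
`exp (-γ a) ≤ tr exp (-γ S)` (`exp_neg_mul_le_trace_exp`), and Markov's inequality reduces the claim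
to a bound on `𝔼[tr exp (-γ S)]`. That bound is obtained one summand at a time
(`integral_trace_exp_neg_add_le`): the Golden–Thompson inequality (`trace_exp_add_le`) splits off
`exp (-γ Z)`, which is at most `1 - (γ - γ²/2) Z` (`exp_neg_smul_le`), and by independence each
summand contributes a factor `1 - (γ - γ²/2) τ/ρ ≤ exp (-(γ - γ²/2) τ/ρ)`. For
`a = (1 - γ) N τ/ρ` the exponents combine to `-N γ² τ / (2ρ)` (`measureReal_not_le_sum_le`), and the
hypothesis on the number of samples makes the failure probability at most
`n (2n)⁻² = 1 / (4n)`. A common lower bound `(τ/ρ) • 1` on the expectations is all that is used, so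
Lieb's concavity theorem is not needed.

The Golden–Thompson inequality itself follows from the Lie product formula
(`tendsto_exp_mul_exp_pow`) along powers of two, together with `tr (A B)^m ≤ tr (A^m B^m)` for
symmetric `A`, `B` and `m` a power of two (`trace_pow_two_pow_le`), which iterates the
Cauchy–Schwarz inequality for the Frobenius inner product.
-/

/-! ### The Lie product formula -/

section LieProduct

open Filter Topology NormedSpace

variable {𝔸 : Type*} [NormedRing 𝔸] [NormedAlgebra ℝ 𝔸] [NormOneClass 𝔸] [CompleteSpace 𝔸]

omit [CompleteSpace 𝔸] in
theorem norm_exp_le_exp_norm (x : 𝔸) : ‖exp x‖ ≤ Real.exp ‖x‖ := by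
  rw [exp_eq_tsum ℝ]
  have h := expSeries_div_hasSum_exp (𝔸 := ℝ) ‖x‖
  rw [← Real.exp_eq_exp_ℝ] at h
  refine tsum_of_norm_bounded h fun k => ?_
  rw [norm_smul, norm_inv, RCLike.norm_natCast, div_eq_inv_mul]
  gcongr
  exact norm_pow_le x k

omit [NormedAlgebra ℝ 𝔸] [CompleteSpace 𝔸] in
/-- Telescoping bound for the difference of two powers in a noncommutative normed ring. -/
theorem norm_pow_sub_pow_le {x y : 𝔸} {M : ℝ} (hM : 1 ≤ M) (hx : ‖x‖ ≤ M) (hy : ‖y‖ ≤ M) (k : ℕ) :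
    ‖x ^ k - y ^ k‖ ≤ k * M ^ k * ‖x - y‖ := by
  induction k with
  | zero => simp
  | succ k ih =>
    have h0 : (0 : ℝ) ≤ M := by linarith
    have hsplit : x ^ (k + 1) - y ^ (k + 1) = x ^ k * (x - y) + (x ^ k - y ^ k) * y := by
      rw [pow_succ, pow_succ]; noncomm_ring
    have h1 : ‖x ^ k * (x - y)‖ ≤ M ^ (k + 1) * ‖x - y‖ := by
      refine (norm_mul_le _ _).trans ?_
      gcongr
      calc ‖x ^ k‖ ≤ ‖x‖ ^ k := norm_pow_le x k
        _ ≤ M ^ k := by gcongr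
        _ ≤ M ^ (k + 1) := pow_le_pow_right₀ hM k.le_succ
    have h2 : ‖(x ^ k - y ^ k) * y‖ ≤ k * M ^ k * ‖x - y‖ * M :=
      (norm_mul_le _ _).trans (mul_le_mul ih hy (norm_nonneg _) (by positivity))
    calc ‖x ^ (k + 1) - y ^ (k + 1)‖ ≤ M ^ (k + 1) * ‖x - y‖ + k * M ^ k * ‖x - y‖ * M := by
          rw [hsplit]; exact (norm_add_le _ _).trans (add_le_add h1 h2)
      _ = ((k + 1 : ℕ) : ℝ) * M ^ (k + 1) * ‖x - y‖ := by push_cast; ring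

omit [NormOneClass 𝔸] in
/-- To first order in `t`, the exponential of a sum is the product of the exponentials. -/
theorem hasDerivAt_exp_smul_mul_exp_smul_sub (a b : 𝔸) : HasDerivAt
    (fun t : ℝ => exp (t • a) * exp (t • b) - exp (t • (a + b))) 0 0 := by
  have h := ((hasDerivAt_exp_smul_const (𝕂 := ℝ) a 0).mul
    (hasDerivAt_exp_smul_const (𝕂 := ℝ) b 0)).sub (hasDerivAt_exp_smul_const (𝕂 := ℝ) (a + b) 0)
  simp only [zero_smul, exp_zero, one_mul, mul_one, sub_self] at h
  exact h

omit [NormOneClass 𝔸] in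
theorem exp_inv_smul_pow (a : 𝔸) {m : ℕ} (hm : m ≠ 0) : exp ((m : ℝ)⁻¹ • a) ^ m = exp a := by
  let _ : NormedAlgebra ℚ 𝔸 := NormedAlgebra.restrictScalars ℚ ℝ 𝔸
  rw [← exp_nsmul, ← Nat.cast_smul_eq_nsmul ℝ, smul_smul, mul_inv_cancel₀ (by exact_mod_cast hm),
    one_smul]

/-- The **Lie product formula**. -/
theorem tendsto_exp_mul_exp_pow (a b : 𝔸) :
    Tendsto (fun m : ℕ => (exp ((m : ℝ)⁻¹ • a) * exp ((m : ℝ)⁻¹ • b)) ^ m) atTop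
      (𝓝 (exp (a + b))) := by
  have hinv : Tendsto (fun m : ℕ => (m : ℝ)⁻¹) atTop (𝓝 0) := tendsto_inv_atTop_nhds_zero_nat
  have ho := ((hasDerivAt_exp_smul_mul_exp_smul_sub a b).isLittleO).comp_tendsto hinv
  have hlim : Tendsto (fun m : ℕ => Real.exp (‖a‖ + ‖b‖) *
      ((m : ℝ) * ‖exp ((m : ℝ)⁻¹ • a) * exp ((m : ℝ)⁻¹ • b) - exp ((m : ℝ)⁻¹ • (a + b))‖))
      atTop (𝓝 0) := by
    rw [← mul_zero (Real.exp (‖a‖ + ‖b‖))]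
    refine Tendsto.const_mul _ ?_
    have := ho.norm_norm.tendsto_div_nhds_zero
    simpa [div_eq_mul_inv, mul_comm] using this
  rw [tendsto_iff_norm_sub_tendsto_zero]
  refine squeeze_zero' (Eventually.of_forall fun _ => norm_nonneg _) ?_ hlim
  filter_upwards [eventually_gt_atTop 0] with m hm
  have hm' : (0 : ℝ) < m := by exact_mod_cast hm
  set M := Real.exp ((m : ℝ)⁻¹ * (‖a‖ + ‖b‖)) with hMdef
  have hM1 : 1 ≤ M := Real.one_le_exp (by positivity)
  have hMm : M ^ m = Real.exp (‖a‖ + ‖b‖) := by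
    rw [hMdef, ← Real.exp_nat_mul]; congr 1; field_simp
  have hs (x : 𝔸) : ‖(m : ℝ)⁻¹ • x‖ = (m : ℝ)⁻¹ * ‖x‖ := by
    rw [norm_smul, Real.norm_of_nonneg (by positivity)]
  have hX : ‖exp ((m : ℝ)⁻¹ • (a + b))‖ ≤ M := by
    refine (norm_exp_le_exp_norm _).trans (Real.exp_le_exp.2 ?_)
    rw [hs]; gcongr; exact norm_add_le a b
  have hY : ‖exp ((m : ℝ)⁻¹ • a) * exp ((m : ℝ)⁻¹ • b)‖ ≤ M := by
    rw [hMdef, mul_add, Real.exp_add, ← hs, ← hs]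
    exact (norm_mul_le _ _).trans (mul_le_mul (norm_exp_le_exp_norm _) (norm_exp_le_exp_norm _)
      (norm_nonneg _) (Real.exp_pos _).le)
  rw [← exp_inv_smul_pow (a + b) hm.ne']
  refine (norm_pow_sub_pow_le hM1 hY hX m).trans_eq ?_
  rw [hMm]; ring

end LieProduct

/-! ### The Golden–Thompson inequality -/

section GoldenThompson

open Matrix Filter Topology

variable {ι : Type*} [Fintype ι] [DecidableEq ι]

omit [DecidableEq ι] in
theorem trace_mul_transpose_self_nonneg (A : Matrix ι ι ℝ) : 0 ≤ (A * Aᵀ).trace := by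
  rw [← conjTranspose_eq_transpose_of_trivial]
  exact (posSemidef_self_mul_conjTranspose A).trace_nonneg

omit [DecidableEq ι] in
/-- The Cauchy–Schwarz inequality for the Frobenius inner product. -/
theorem trace_mul_le_sqrt_mul_sqrt (A B : Matrix ι ι ℝ) :
    (A * B).trace ≤ √(A * Aᵀ).trace * √(B * Bᵀ).trace := by
  have h (A B : Matrix ι ι ℝ) : (A * B).trace = ∑ p : ι × ι, A p.1 p.2 * Bᵀ p.1 p.2 := by
    simp [Matrix.trace, Matrix.mul_apply, Fintype.sum_prod_type]
  have hB : (B * Bᵀ).trace = (Bᵀ * Bᵀᵀ).trace := by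
    rw [transpose_transpose, trace_mul_comm]
  rw [hB, h, h, h]
  simp only [transpose_transpose, ← sq]
  exact Real.sum_mul_le_sqrt_mul_sqrt _ _ _

theorem trace_mul_pow_comm (A B : Matrix ι ι ℝ) (m : ℕ) :
    ((A * B) ^ m).trace = ((B * A) ^ m).trace := by
  cases m with
  | zero => simp
  | succ m =>
    have h : (A * B) ^ m * A = A * (B * A) ^ m := by
      induction m with
      | zero => simp
      | succ m ih => rw [pow_succ', mul_assoc, ih, pow_succ']; simp only [mul_assoc]
    rw [pow_succ, ← mul_assoc, h, trace_mul_comm, ← mul_assoc, pow_succ']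

/-- The trace inequalities `tr (AB)^m ≤ tr (A^m B^m)` for symmetric `A`, `B` and
`tr X^(2m) ≤ tr (X Xᵀ)^m` for arbitrary `X`, with `m` a power of two.  Each is used in the
induction step of the other, so they are proved together. -/
theorem trace_pow_two_pow_le (k : ℕ) :
    (∀ A B : Matrix ι ι ℝ, A.IsSymm → B.IsSymm →
      ((A * B) ^ 2 ^ k).trace ≤ (A ^ 2 ^ k * B ^ 2 ^ k).trace) ∧
    (∀ X : Matrix ι ι ℝ, (X ^ 2 ^ (k + 1)).trace ≤ ((X * Xᵀ) ^ 2 ^ k).trace) := by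
  induction k with
  | zero =>
    refine ⟨fun A B _ _ => by simp, fun X => ?_⟩
    have h := trace_mul_le_sqrt_mul_sqrt X X
    rw [Real.mul_self_sqrt (trace_mul_transpose_self_nonneg X)] at h
    simpa [sq] using h
  | succ k ih =>
    obtain ⟨ihAB, ihX⟩ := ih
    refine ⟨fun A B hA hB => ?_, fun X => ?_⟩
    · calc ((A * B) ^ 2 ^ (k + 1)).trace ≤ ((A * B * (A * B)ᵀ) ^ 2 ^ k).trace := ihX _
        _ = ((A ^ 2 * B ^ 2) ^ 2 ^ k).trace := by
          rw [transpose_mul, hA.eq, hB.eq, mul_assoc, trace_mul_pow_comm, ← mul_assoc,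
            mul_assoc, ← sq, trace_mul_pow_comm]
          simp only [sq, mul_assoc]
        _ ≤ ((A ^ 2) ^ 2 ^ k * (B ^ 2) ^ 2 ^ k).trace := ihAB _ _ (hA.pow 2) (hB.pow 2)
        _ = _ := by rw [← pow_mul, ← pow_mul, ← pow_succ']
    · set S := X * Xᵀ with hS
      set R := Xᵀ * X with hR
      have hSs : S.IsSymm := isSymm_mul_transpose_self X
      have hRs : R.IsSymm := isSymm_transpose_mul_self X
      -- `tr (X² X²ᵀ)^m = tr (R S)^m`, where `R` and `S` have powers of equal trace.
      have hsq (Q : Matrix ι ι ℝ) (hQ : Q.IsSymm) :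
          (Q ^ 2 ^ k * (Q ^ 2 ^ k)ᵀ).trace = (Q ^ 2 ^ (k + 1)).trace := by
        rw [(hQ.pow _).eq, ← pow_add, ← two_mul, ← pow_succ']
      have hRS : (R ^ 2 ^ (k + 1)).trace = (S ^ 2 ^ (k + 1)).trace :=
        trace_mul_pow_comm Xᵀ X _
      have h0 : 0 ≤ (S ^ 2 ^ (k + 1)).trace := by
        rw [← hsq S hSs]
        exact trace_mul_transpose_self_nonneg _
      calc (X ^ 2 ^ (k + 1 + 1)).trace = ((X ^ 2) ^ 2 ^ (k + 1)).trace := by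
            rw [← pow_mul, ← pow_succ']
        _ ≤ ((X ^ 2 * (X ^ 2)ᵀ) ^ 2 ^ k).trace := ihX _
        _ = ((R * S) ^ 2 ^ k).trace := by
          rw [hR, hS, sq, transpose_mul, mul_assoc, trace_mul_pow_comm,
            trace_mul_pow_comm (Xᵀ * X)]
          simp only [mul_assoc]
        _ ≤ (R ^ 2 ^ k * S ^ 2 ^ k).trace := ihAB _ _ hRs hSs
        _ ≤ √(R ^ 2 ^ (k + 1)).trace * √(S ^ 2 ^ (k + 1)).trace := by
          rw [← hsq R hRs, ← hsq S hSs]; exact trace_mul_le_sqrt_mul_sqrt _ _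
        _ = (S ^ 2 ^ (k + 1)).trace := by rw [hRS, Real.mul_self_sqrt h0]

open scoped Matrix.Norms.L2Operator in
/-- The **Golden–Thompson inequality** for real symmetric matrices. -/
theorem trace_exp_add_le [Nonempty ι] {A B : Matrix ι ι ℝ} (hA : A.IsSymm) (hB : B.IsSymm) :
    (NormedSpace.exp (A + B)).trace ≤ (NormedSpace.exp A * NormedSpace.exp B).trace := by
  have hpow : Tendsto (fun k : ℕ => 2 ^ k) atTop atTop :=
    tendsto_pow_atTop_atTop_of_one_lt one_lt_two
  have hlim := (tendsto_exp_mul_exp_pow A B).comp hpow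
  have htr : Continuous (Matrix.trace : Matrix ι ι ℝ → ℝ) := continuous_id.matrix_trace
  refine le_of_tendsto ((htr.tendsto _).comp hlim) (Eventually.of_forall fun k => ?_)
  have := (trace_pow_two_pow_le k).1 _ _ (hA.smul (((2 ^ k : ℕ) : ℝ)⁻¹)).exp
    (hB.smul (((2 ^ k : ℕ) : ℝ)⁻¹)).exp
  rwa [exp_inv_smul_pow A (by positivity), exp_inv_smul_pow B (by positivity)] at this

end GoldenThompson

/-! ### Matrix exponentials in the Loewner order -/

section LoewnerExponential

open Matrix
open scoped Matrix.Norms.L2Operator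

variable {ι : Type*} [Fintype ι] [DecidableEq ι]

omit [DecidableEq ι] in
theorem trace_mul_nonneg {A B : Matrix ι ι ℝ} (hA : 0 ≤ A) (hB : 0 ≤ B) : 0 ≤ (A * B).trace := by
  classical
  obtain ⟨C, rfl⟩ := CStarAlgebra.nonneg_iff_eq_star_mul_self.mp hA
  rw [mul_assoc, trace_mul_comm]
  exact (hB.posSemidef.mul_mul_conjTranspose_same C).trace_nonneg

omit [DecidableEq ι] in
theorem trace_mul_le_trace_mul {G A B : Matrix ι ι ℝ} (hG : 0 ≤ G) (hAB : A ≤ B) :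
    (G * A).trace ≤ (G * B).trace := by
  have h := trace_mul_nonneg hG (sub_nonneg.2 hAB)
  rwa [mul_sub, trace_sub, sub_nonneg] at h

theorem exp_smul_eq_cfc {A : Matrix ι ι ℝ} (hA : IsSelfAdjoint A) (θ : ℝ) :
    NormedSpace.exp (θ • A) = cfc (fun x => Real.exp (θ * x)) A := by
  have hθA : IsSelfAdjoint (θ • A) := (IsSelfAdjoint.all θ).smul hA
  rw [← CFC.real_exp_eq_normedSpace_exp hθA, ← cfc_comp_const_mul θ Real.exp A]

/-- Matrix form of the scalar bound `e^{-x} ≤ 1 - x + x²/2 ≤ 1 - (γ - γ²/2) z`, where `x = γ z`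
and `0 ≤ z ≤ 1`. -/
theorem exp_neg_smul_le {γ : ℝ} (hγ : 0 ≤ γ) {Z : Matrix ι ι ℝ} (h0 : 0 ≤ Z) (h1 : Z ≤ 1) :
    NormedSpace.exp (-γ • Z) ≤ 1 - (γ - γ ^ 2 / 2) • Z := by
  have hZ : IsSelfAdjoint Z := h0.isSelfAdjoint
  have hR : 1 - (γ - γ ^ 2 / 2) • Z = cfc (fun x : ℝ => 1 - (γ - γ ^ 2 / 2) * x) Z := by
    rw [cfc_sub (fun _ : ℝ => (1 : ℝ)) (fun x => (γ - γ ^ 2 / 2) * x) Z, cfc_const_one ℝ Z,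
      cfc_const_mul_id _ Z]
  rw [exp_smul_eq_cfc hZ, hR]
  refine cfc_mono fun x hx => ?_
  have hx0 : 0 ≤ x := spectrum_nonneg_of_nonneg h0 hx
  have hx1 : x ≤ 1 := (le_algebraMap_iff_spectrum_le (r := (1 : ℝ))).1 (by simpa using h1) x hx
  have hγx : 0 ≤ γ * x := by positivity
  have hq : 1 + γ * x + (γ * x) ^ 2 / 2 ≤ Real.exp (γ * x) := Real.quadratic_le_exp_of_nonneg hγx
  have hexp : Real.exp (-γ * x) ≤ 1 - γ * x + (γ * x) ^ 2 / 2 := by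
    rw [neg_mul, Real.exp_neg]
    refine (inv_anti₀ (by positivity) hq).trans ((inv_le_iff_one_le_mul₀ (by positivity)).2 ?_)
    -- `(1 - u + u²/2) (1 + u + u²/2) = 1 + u⁴/4 ≥ 1`
    nlinarith [sq_nonneg ((γ * x) ^ 2)]
  nlinarith [mul_nonneg (sq_nonneg γ) (mul_nonneg hx0 (sub_nonneg.2 hx1))]

/-- If `a` is not a lower bound for the symmetric matrix `S`, some eigenvalue of `S` lies
below `a`, and its exponential is one of the nonnegative summands of the trace. -/
theorem exp_neg_mul_le_trace_exp {γ a : ℝ} (hγ : 0 ≤ γ) {S : Matrix ι ι ℝ} (hS : S.IsHermitian)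
    (h : ¬ a • (1 : Matrix ι ι ℝ) ≤ S) :
    Real.exp (-γ * a) ≤ (NormedSpace.exp (-γ • S)).trace := by
  have hex : ∃ i, hS.eigenvalues i < a := by
    by_contra! hall
    refine h ?_
    rw [← Algebra.algebraMap_eq_smul_one, algebraMap_le_iff_le_spectrum hS.isSelfAdjoint]
    intro x hx
    rw [hS.spectrum_real_eq_range_eigenvalues] at hx
    obtain ⟨i, rfl⟩ := hx
    exact hall i
  obtain ⟨i, hi⟩ := hex
  have htr : (NormedSpace.exp (-γ • S)).trace = ∑ i, Real.exp (-γ * hS.eigenvalues i) := by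
    rw [exp_smul_eq_cfc hS.isSelfAdjoint, hS.cfc_eq, IsHermitian.cfc, Unitary.conjStarAlgAut_apply,
      trace_mul_comm, ← mul_assoc]
    simp [Matrix.trace]
  rw [htr]
  calc Real.exp (-γ * a) ≤ Real.exp (-γ * hS.eigenvalues i) := by
        apply Real.exp_le_exp.2; nlinarith
    _ ≤ _ := Finset.single_le_sum (f := fun i => Real.exp (-γ * hS.eigenvalues i))
        (fun _ _ => (Real.exp_pos _).le) (Finset.mem_univ i)

theorem exp_smul_nonneg {A : Matrix ι ι ℝ} (hA : IsSelfAdjoint A) (θ : ℝ) :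
    0 ≤ NormedSpace.exp (θ • A) := by
  rw [exp_smul_eq_cfc hA]
  exact cfc_nonneg fun x _ => (Real.exp_pos _).le

theorem exp_neg_smul_le_one {γ : ℝ} (hγ : 0 ≤ γ) {S : Matrix ι ι ℝ} (hS : 0 ≤ S) :
    NormedSpace.exp (-γ • S) ≤ 1 := by
  have hSa : IsSelfAdjoint S := hS.isSelfAdjoint
  rw [exp_smul_eq_cfc hSa, ← cfc_const_one ℝ S]
  refine cfc_mono fun x hx => Real.exp_le_one_iff.2 ?_
  have := mul_nonneg hγ (spectrum_nonneg_of_nonneg hS hx)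
  linarith

omit [DecidableEq ι] in
/-- The inequality `2 |Aᵢⱼ| ≤ Aᵢᵢ + Aⱼⱼ`, weakened to a bound that is monotone in `A`. -/
theorem abs_apply_le_trace {A : Matrix ι ι ℝ} (hA : 0 ≤ A) (i j : ι) : |A i j| ≤ A.trace := by
  classical
  have hdiag (k : ι) : A k k ≤ A.trace :=
    Finset.single_le_sum (f := fun k => A k k) (fun k _ => hA.posSemidef.diag_nonneg)
      (Finset.mem_univ k)
  obtain ⟨C, rfl⟩ := CStarAlgebra.nonneg_iff_eq_star_mul_self.mp hA
  have hij : 2 * |(star C * C) i j| ≤ (star C * C) i i + (star C * C) j j := by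
    simp only [star_eq_conjTranspose, mul_apply, conjTranspose_apply, star_trivial]
    rw [← Finset.sum_add_distrib]
    refine (mul_le_mul_of_nonneg_left (Finset.abs_sum_le_sum_abs _ _) zero_le_two).trans ?_
    rw [Finset.mul_sum]
    refine Finset.sum_le_sum fun k _ => ?_
    rw [abs_mul]
    nlinarith [sq_nonneg (|C k i| - |C k j|), abs_mul_abs_self (C k i), abs_mul_abs_self (C k j)]
  linarith [hdiag i, hdiag j]

end LoewnerExponential

/-! ### Measurability, expectation and independence of random matrices -/

section RandomMatrices

open Matrix

variable {n : ℕ}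

instance matrixBorelSpace : BorelSpace (Matrix (Fin n) (Fin n) ℝ) :=
  inferInstanceAs (BorelSpace (Fin n → Fin n → ℝ))

instance matrixMeasurableAdd₂ : MeasurableAdd₂ (Matrix (Fin n) (Fin n) ℝ) :=
  inferInstanceAs (MeasurableAdd₂ (Fin n → Fin n → ℝ))

theorem measurable_matrix_entry (i j : Fin n) :
    Measurable fun A : Matrix (Fin n) (Fin n) ℝ => A i j :=
  (continuous_id.matrix_elem i j).measurable

theorem isClosed_setOf_nonneg_matrix : IsClosed {A : Matrix (Fin n) (Fin n) ℝ | 0 ≤ A} := by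
  have h : {A : Matrix (Fin n) (Fin n) ℝ | 0 ≤ A}
      = {A | Aᴴ = A} ∩ ⋂ x : Fin n → ℝ, {A | 0 ≤ star x ⬝ᵥ (A *ᵥ x)} := by
    ext A
    simp [nonneg_iff_posSemidef, posSemidef_iff_dotProduct_mulVec, IsHermitian]
  rw [h]
  refine (isClosed_eq (continuous_id.matrix_conjTranspose) continuous_id).inter
    (isClosed_iInter fun x => isClosed_le continuous_const ?_)
  exact Continuous.dotProduct continuous_const (continuous_id.matrix_mulVec continuous_const)

theorem measurableSet_matrix_Icc (Y : Matrix (Fin n) (Fin n) ℝ) :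
    MeasurableSet {A : Matrix (Fin n) (Fin n) ℝ | 0 ≤ A ∧ A ≤ Y} := by
  have h : {A : Matrix (Fin n) (Fin n) ℝ | A ≤ Y} = (fun A => Y - A) ⁻¹' {A | 0 ≤ A} := by
    ext A; simp
  refine (isClosed_setOf_nonneg_matrix.inter ?_).measurableSet
  change IsClosed {A : Matrix (Fin n) (Fin n) ℝ | A ≤ Y}
  rw [h]
  exact isClosed_setOf_nonneg_matrix.preimage (continuous_const.sub continuous_id)

variable {Ω : Type*} [MeasurableSpace Ω] {P : Measure Ω}

theorem matrixExpectation_mul_mul {X : Ω → Matrix (Fin n) (Fin n) ℝ}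
    (hX : ∀ i j, Integrable (fun ω => X ω i j) P) (C D : Matrix (Fin n) (Fin n) ℝ) :
    matrixExpectation (fun ω => C * X ω * D) P = C * matrixExpectation X P * D := by
  ext i j
  simp only [matrixExpectation, of_apply, mul_apply]
  rw [integral_finsetSum _ fun k _ => (integrable_finsetSum _ fun l _ =>
    (hX l k).const_mul _).mul_const _]
  refine Finset.sum_congr rfl fun k _ => ?_
  rw [integral_mul_const, integral_finsetSum _ fun l _ => (hX l k).const_mul _]
  simp only [integral_const_mul]

theorem matrixExpectation_nonneg {G : Ω → Matrix (Fin n) (Fin n) ℝ}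
    (hG : ∀ i j, Integrable (fun ω => G ω i j) P) (h0 : ∀ᵐ ω ∂P, 0 ≤ G ω) :
    0 ≤ matrixExpectation G P := by
  rw [nonneg_iff_posSemidef, posSemidef_iff_dotProduct_mulVec]
  refine ⟨?_, fun x => ?_⟩
  · ext i j
    simp only [conjTranspose_apply, matrixExpectation, of_apply, star_trivial]
    refine integral_congr_ae (h0.mono fun ω h => ?_)
    simpa using h.posSemidef.isHermitian.apply i j
  · have h : star x ⬝ᵥ (matrixExpectation G P *ᵥ x) = ∫ ω, star x ⬝ᵥ (G ω *ᵥ x) ∂P := by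
      simp only [dotProduct, mulVec, matrixExpectation, of_apply]
      rw [integral_finsetSum _ fun k _ => (integrable_finsetSum _ fun l _ =>
        (hG k l).mul_const _).const_mul _]
      refine Finset.sum_congr rfl fun k _ => ?_
      rw [integral_const_mul, integral_finsetSum _ fun l _ => (hG k l).mul_const _]
      simp only [integral_mul_const]
    rw [h]
    exact integral_nonneg_of_ae (h0.mono fun ω h => h.posSemidef.dotProduct_mulVec_nonneg x)

theorem integrable_trace {G : Ω → Matrix (Fin n) (Fin n) ℝ}
    (hG : ∀ i j, Integrable (fun ω => G ω i j) P) : Integrable (fun ω => (G ω).trace) P :=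
  integrable_finsetSum _ fun i _ => hG i i

theorem trace_matrixExpectation {G : Ω → Matrix (Fin n) (Fin n) ℝ}
    (hG : ∀ i j, Integrable (fun ω => G ω i j) P) :
    (matrixExpectation G P).trace = ∫ ω, (G ω).trace ∂P :=
  (integral_finsetSum _ fun i _ => hG i i).symm

theorem indepFun_entry {G Z : Ω → Matrix (Fin n) (Fin n) ℝ} (hGZ : IndepFun G Z P)
    (i j k l : Fin n) : IndepFun (fun ω => G ω i j) (fun ω => Z ω k l) P :=
  hGZ.comp (measurable_matrix_entry i j) (measurable_matrix_entry k l)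

theorem integrable_mul_apply_of_indepFun {G Z : Ω → Matrix (Fin n) (Fin n) ℝ}
    (hG : ∀ i j, Integrable (fun ω => G ω i j) P) (hZ : ∀ i j, Integrable (fun ω => Z ω i j) P)
    (hGZ : IndepFun G Z P) (i j : Fin n) : Integrable (fun ω => (G ω * Z ω) i j) P := by
  simp only [mul_apply]
  exact integrable_finsetSum _ fun k _ =>
    (indepFun_entry hGZ i k k j).integrable_mul (hG i k) (hZ k j)

theorem matrixExpectation_mul_of_indepFun {G Z : Ω → Matrix (Fin n) (Fin n) ℝ}
    (hG : ∀ i j, Integrable (fun ω => G ω i j) P) (hZ : ∀ i j, Integrable (fun ω => Z ω i j) P)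
    (hGZ : IndepFun G Z P) : matrixExpectation (fun ω => G ω * Z ω) P
      = matrixExpectation G P * matrixExpectation Z P := by
  ext i j
  have hint (k : Fin n) : Integrable (fun ω => G ω i k * Z ω k j) P :=
    (indepFun_entry hGZ i k k j).integrable_mul (hG i k) (hZ k j)
  simp only [matrixExpectation, of_apply, mul_apply]
  rw [integral_finsetSum _ fun k _ => hint k]
  exact Finset.sum_congr rfl fun k _ =>
    (indepFun_entry hGZ i k k j).integral_mul_eq_mul_integral
      (hG i k).aestronglyMeasurable (hZ k j).aestronglyMeasurable

theorem integrable_entry_of_nonneg_of_le [IsFiniteMeasure P] {X : Ω → Matrix (Fin n) (Fin n) ℝ}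
    (hX : AEMeasurable X P) {Y : Matrix (Fin n) (Fin n) ℝ}
    (h : ∀ᵐ ω ∂P, 0 ≤ X ω ∧ X ω ≤ Y) (i j : Fin n) : Integrable (fun ω => X ω i j) P := by
  refine Integrable.of_bound
    ((measurable_matrix_entry i j).comp_aemeasurable hX).aestronglyMeasurable Y.trace ?_
  filter_upwards [h] with ω hω
  refine (abs_apply_le_trace hω.1 i j).trans ?_
  have := (le_iff.1 hω.2).trace_nonneg
  rwa [trace_sub, sub_nonneg] at this

end RandomMatrices

/-! ### The matrix Laplace transform and the Chernoff lower tail -/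

section LaplaceTransform

open Matrix
open scoped Matrix.Norms.L2Operator

variable {n : ℕ} {Ω : Type*} [MeasurableSpace Ω] {P : Measure Ω} [IsProbabilityMeasure P]

theorem measurable_exp_smul (θ : ℝ) :
    Measurable fun A : Matrix (Fin n) (Fin n) ℝ => NormedSpace.exp (θ • A) := by
  let _ : NormedAlgebra ℚ (Matrix (Fin n) (Fin n) ℝ) := NormedAlgebra.restrictScalars ℚ ℝ _
  exact (NormedSpace.exp_continuous.comp (continuous_const_smul θ)).measurable

omit [IsProbabilityMeasure P] in
theorem ae_exp_neg_smul_mem_Icc {γ : ℝ} (hγ : 0 ≤ γ) {S : Ω → Matrix (Fin n) (Fin n) ℝ}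
    (hS0 : ∀ᵐ ω ∂P, 0 ≤ S ω) : ∀ᵐ ω ∂P,
      0 ≤ NormedSpace.exp (-γ • S ω) ∧ NormedSpace.exp (-γ • S ω) ≤ 1 :=
  hS0.mono fun _ h => ⟨exp_smul_nonneg h.isSelfAdjoint _, exp_neg_smul_le_one hγ h⟩

theorem integrable_exp_neg_smul_apply {γ : ℝ} (hγ : 0 ≤ γ) {S : Ω → Matrix (Fin n) (Fin n) ℝ}
    (hS : AEMeasurable S P) (hS0 : ∀ᵐ ω ∂P, 0 ≤ S ω) (i j : Fin n) :
    Integrable (fun ω => NormedSpace.exp (-γ • S ω) i j) P :=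
  integrable_entry_of_nonneg_of_le ((measurable_exp_smul _).comp_aemeasurable hS)
    (ae_exp_neg_smul_mem_Icc hγ hS0) i j

/-- Adding an independent summand `Z` with `0 ≤ Z ≤ 1` and `τ • 1 ≤ 𝔼[Z]` contracts the trace
exponential moment: Golden–Thompson splits off `exp (-γ Z)`, which is at most
`1 - (γ - γ²/2) Z`, and independence lets the expectation of `Z` be taken separately. -/
theorem integral_trace_exp_neg_add_le [NeZero n] {γ τ : ℝ} (hγ0 : 0 ≤ γ) (hγ1 : γ ≤ 1)
    {S Z : Ω → Matrix (Fin n) (Fin n) ℝ} (hS : AEMeasurable S P) (hZ : AEMeasurable Z P)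
    (hS0 : ∀ᵐ ω ∂P, 0 ≤ S ω) (hZb : ∀ᵐ ω ∂P, 0 ≤ Z ω ∧ Z ω ≤ 1)
    (hEZ : τ • 1 ≤ matrixExpectation Z P) (hSZ : IndepFun S Z P) :
    ∫ ω, (NormedSpace.exp (-γ • (S ω + Z ω))).trace ∂P
      ≤ (1 - (γ - γ ^ 2 / 2) * τ) * ∫ ω, (NormedSpace.exp (-γ • S ω)).trace ∂P := by
  set c := γ - γ ^ 2 / 2 with hc
  have hc0 : 0 ≤ c := by nlinarith
  set G : Ω → Matrix (Fin n) (Fin n) ℝ := fun ω => NormedSpace.exp (-γ • S ω) with hG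
  have hGint : ∀ i j, Integrable (fun ω => G ω i j) P := integrable_exp_neg_smul_apply hγ0 hS hS0
  have hZint : ∀ i j, Integrable (fun ω => Z ω i j) P := integrable_entry_of_nonneg_of_le hZ hZb
  have hGZ : IndepFun G Z P := hSZ.comp (measurable_exp_smul (-γ)) measurable_id
  have hGZint := integrable_mul_apply_of_indepFun hGint hZint hGZ
  have hEG : 0 ≤ matrixExpectation G P :=
    matrixExpectation_nonneg hGint ((ae_exp_neg_smul_mem_Icc hγ0 hS0).mono fun _ h => h.1)
  have hSZ0 : ∀ᵐ ω ∂P, 0 ≤ S ω + Z ω := by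
    filter_upwards [hS0, hZb] with ω h1 h2 using add_nonneg h1 h2.1
  have hpt : ∀ᵐ ω ∂P, (NormedSpace.exp (-γ • (S ω + Z ω))).trace
      ≤ (G ω).trace - c * (G ω * Z ω).trace := by
    filter_upwards [hS0, hZb] with ω h1 h2
    have hsymm {A : Matrix (Fin n) (Fin n) ℝ} (hA : 0 ≤ A) : (-γ • A).IsSymm :=
      IsSymm.smul ((conjTranspose_eq_transpose_of_trivial A).symm.trans hA.posSemidef.isHermitian.eq) _
    calc (NormedSpace.exp (-γ • (S ω + Z ω))).trace
        ≤ (G ω * NormedSpace.exp (-γ • Z ω)).trace := by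
          rw [smul_add]; exact trace_exp_add_le (hsymm h1) (hsymm h2.1)
      _ ≤ (G ω * (1 - c • Z ω)).trace :=
          trace_mul_le_trace_mul (exp_smul_nonneg h1.isSelfAdjoint _)
            (exp_neg_smul_le hγ0 h2.1 h2.2)
      _ = (G ω).trace - c * (G ω * Z ω).trace := by
          rw [mul_sub, mul_one, mul_smul_comm, trace_sub, trace_smul, smul_eq_mul]
  have hmean : τ * ∫ ω, (G ω).trace ∂P ≤ ∫ ω, (G ω * Z ω).trace ∂P := by
    rw [← trace_matrixExpectation hGint, ← trace_matrixExpectation hGZint,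
      matrixExpectation_mul_of_indepFun hGint hZint hGZ]
    have h := trace_mul_le_trace_mul hEG hEZ
    rwa [mul_smul_comm, mul_one, trace_smul, smul_eq_mul] at h
  calc ∫ ω, (NormedSpace.exp (-γ • (S ω + Z ω))).trace ∂P
      ≤ ∫ ω, ((G ω).trace - c * (G ω * Z ω).trace) ∂P :=
        integral_mono_ae
          (integrable_trace (integrable_exp_neg_smul_apply hγ0 (hS.add hZ) hSZ0))
          ((integrable_trace hGint).sub ((integrable_trace hGZint).const_mul c)) hpt
    _ = ∫ ω, (G ω).trace ∂P - c * ∫ ω, (G ω * Z ω).trace ∂P := by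
        rw [integral_sub (integrable_trace hGint) ((integrable_trace hGZint).const_mul c),
          integral_const_mul]
    _ ≤ (1 - c * τ) * ∫ ω, (G ω).trace ∂P := by
        have := mul_le_mul_of_nonneg_left hmean hc0
        linarith

/-- The contraction factor contributed by each summand is nonnegative. -/
theorem one_sub_rate_mul_nonneg {γ τ : ℝ} (hγ0 : 0 ≤ γ) (hγ1 : γ ≤ 1) (hτ0 : 0 ≤ τ) (hτ1 : τ ≤ 1) :
    0 ≤ 1 - (γ - γ ^ 2 / 2) * τ := by
  have : γ - γ ^ 2 / 2 ≤ 1 := by nlinarith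
  have : 0 ≤ γ - γ ^ 2 / 2 := by nlinarith
  nlinarith

/-- Iterating the contraction from the empty sum, where the trace is `tr 1 = n`. -/
theorem integral_trace_exp_neg_sum_le [NeZero n] {ι : Type*} {γ τ : ℝ} (hγ0 : 0 ≤ γ) (hγ1 : γ ≤ 1)
    (hτ0 : 0 ≤ τ) (hτ1 : τ ≤ 1) {Z : ι → Ω → Matrix (Fin n) (Fin n) ℝ}
    (hZ : ∀ t, AEMeasurable (Z t) P) (hZb : ∀ t, ∀ᵐ ω ∂P, 0 ≤ Z t ω ∧ Z t ω ≤ 1)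
    (hEZ : ∀ t, τ • 1 ≤ matrixExpectation (Z t) P) (hind : iIndepFun Z P) (s : Finset ι) :
    ∫ ω, (NormedSpace.exp (-γ • ∑ t ∈ s, Z t ω)).trace ∂P
      ≤ n * (1 - (γ - γ ^ 2 / 2) * τ) ^ s.card := by
  classical
  induction s using Finset.induction_on with
  | empty => simp
  | insert a s ha ih =>
    have hS : AEMeasurable (fun ω => ∑ t ∈ s, Z t ω) P := Finset.aemeasurable_fun_sum s fun t _ => hZ t
    have hS0 : ∀ᵐ ω ∂P, 0 ≤ ∑ t ∈ s, Z t ω := by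
      filter_upwards [(Filter.eventually_all_finset s).2 fun t _ => hZb t] with ω h
      exact Finset.sum_nonneg fun t ht => (h t ht).1
    have hSZ : IndepFun (fun ω => ∑ t ∈ s, Z t ω) (Z a) P := by
      have := hind.indepFun_finsetSum_of_notMem₀ hZ ha
      rwa [Finset.sum_fn] at this
    have hc : 0 ≤ 1 - (γ - γ ^ 2 / 2) * τ := one_sub_rate_mul_nonneg hγ0 hγ1 hτ0 hτ1
    have h := integral_trace_exp_neg_add_le hγ0 hγ1 hS (hZ a) hS0 (hZb a) (hEZ a) hSZ
    simp only [Finset.sum_insert ha, Finset.card_insert_of_notMem ha]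
    simp only [add_comm (Z a _)]
    refine h.trans ((mul_le_mul_of_nonneg_left ih hc).trans_eq ?_)
    ring

/-- The lower tail of the matrix Chernoff bound, for summands normalised to `0 ≤ Z ≤ 1`. The Laplace
parameter is taken to be `γ` itself rather than the optimal `-log (1 - γ)`; this already gives the
rate `γ² / 2`. -/
theorem measureReal_not_le_sum_le [NeZero n] {ι : Type*} [Fintype ι] {γ τ : ℝ} (hγ0 : 0 ≤ γ)
    (hγ1 : γ ≤ 1) (hτ0 : 0 ≤ τ) (hτ1 : τ ≤ 1) {Z : ι → Ω → Matrix (Fin n) (Fin n) ℝ}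
    (hZ : ∀ t, AEMeasurable (Z t) P) (hZb : ∀ t, ∀ᵐ ω ∂P, 0 ≤ Z t ω ∧ Z t ω ≤ 1)
    (hEZ : ∀ t, τ • 1 ≤ matrixExpectation (Z t) P) (hind : iIndepFun Z P) :
    P.real {ω | ¬ ((1 - γ) * τ * Fintype.card ι) • 1 ≤ ∑ t, Z t ω}
      ≤ n * Real.exp (-(Fintype.card ι * τ * γ ^ 2 / 2)) := by
  set N : ℝ := (Fintype.card ι : ℝ) with hN
  set a := (1 - γ) * τ * N with ha
  have hN0 : 0 ≤ N := Nat.cast_nonneg _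
  have hS : AEMeasurable (fun ω => ∑ t, Z t ω) P := Finset.aemeasurable_fun_sum _ fun t _ => hZ t
  have hS0 : ∀ᵐ ω ∂P, 0 ≤ ∑ t, Z t ω := by
    filter_upwards [Filter.eventually_all.2 hZb] with ω h
    exact Finset.sum_nonneg fun t _ => (h t).1
  set f : Ω → ℝ := fun ω => (NormedSpace.exp (-γ • ∑ t, Z t ω)).trace with hf
  have hfint : Integrable f P := integrable_trace (integrable_exp_neg_smul_apply hγ0 hS hS0)
  have hf0 : 0 ≤ᵐ[P] f :=
    hS0.mono fun ω h => (exp_smul_nonneg h.isSelfAdjoint _).posSemidef.trace_nonneg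
  have hmarkov := mul_meas_ge_le_integral_of_nonneg hf0 hfint (Real.exp (-γ * a))
  have hsub : P.real {ω | ¬ a • 1 ≤ ∑ t, Z t ω} ≤ P.real {ω | Real.exp (-γ * a) ≤ f ω} := by
    refine ENNReal.toReal_mono (measure_ne_top _ _) (measure_mono_ae ?_)
    filter_upwards [hS0] with ω h hω
    exact exp_neg_mul_le_trace_exp hγ0 h.posSemidef.isHermitian hω
  have hint := integral_trace_exp_neg_sum_le hγ0 hγ1 hτ0 hτ1 hZ hZb hEZ hind Finset.univ
  have hpow : (1 - (γ - γ ^ 2 / 2) * τ) ^ (Finset.univ : Finset ι).card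
      ≤ Real.exp (-((γ - γ ^ 2 / 2) * τ) * N) := by
    have hc : 0 ≤ 1 - (γ - γ ^ 2 / 2) * τ := one_sub_rate_mul_nonneg hγ0 hγ1 hτ0 hτ1
    rw [mul_comm _ N, hN, Real.exp_nat_mul, Finset.card_univ]
    refine pow_le_pow_left₀ hc ?_ _
    linarith [Real.add_one_le_exp (-((γ - γ ^ 2 / 2) * τ))]
  have hchain : Real.exp (-γ * a) * P.real {ω | ¬ a • 1 ≤ ∑ t, Z t ω}
      ≤ n * Real.exp (-((γ - γ ^ 2 / 2) * τ) * N) :=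
    calc _ ≤ Real.exp (-γ * a) * P.real {ω | Real.exp (-γ * a) ≤ f ω} := by gcongr
      _ ≤ ∫ ω, f ω ∂P := hmarkov
      _ ≤ _ := hint.trans (by gcongr)
  have hsplit : (n : ℝ) * Real.exp (-((γ - γ ^ 2 / 2) * τ) * N)
      = Real.exp (-γ * a) * (n * Real.exp (-(N * τ * γ ^ 2 / 2))) := by
    rw [mul_left_comm, ← Real.exp_add]
    congr 2
    rw [ha]; ring
  rw [hsplit] at hchain
  exact le_of_mul_le_mul_left hchain (Real.exp_pos _)

end LaplaceTransform

/-! ### Normalisation and conclusion -/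

/-- Here `A ≤ B` on matrices is the Loewner order: `B - A` is (symmetric) positive
semidefinite. -/
theorem mainTheorem11 {n : ℕ} (hn : 0 < n)
    (γ : ℝ) (hγ0 : 0 < γ) (hγ1 : γ < 1)
    (τ ρ : ℝ) (hτ : 0 < τ) (hρ : 0 ≤ ρ)
    (Y : Matrix (Fin n) (Fin n) ℝ) (hY : Y.PosDef)
    {Ω : Type*} [MeasurableSpace Ω] (P : Measure Ω) [IsProbabilityMeasure P]
    (X : Ω → Matrix (Fin n) (Fin n) ℝ) (hX : AEMeasurable X P)
    (hXbd : ∀ᵐ ω ∂P, 0 ≤ X ω ∧ X ω ≤ ρ • Y)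
    (hEX : τ • Y ≤ matrixExpectation X P)
    (T : ℕ) (hT : ⌈4 * ρ / (γ ^ 2 * τ) * Real.log (2 * (n : ℝ))⌉ ≤ (T : ℤ))
    {Ω' : Type*} [MeasurableSpace Ω'] (P' : Measure Ω') [IsProbabilityMeasure P']
    (Xs : Fin T → Ω' → Matrix (Fin n) (Fin n) ℝ)
    (hident : ∀ t, IdentDistrib (Xs t) X P' P)
    (hindep : iIndepFun Xs P') :
    1 - 1 / (2 * (n : ℝ)) ≤
      P'.real {ω | ((1 - γ) * τ) • Y ≤ (1 / (T : ℝ)) • ∑ t, Xs t ω} := by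
  have : NeZero n := ⟨hn.ne'⟩
  have hn1 : (1 : ℝ) ≤ n := by exact_mod_cast hn
  have hXint := integrable_entry_of_nonneg_of_le hX hXbd
  -- Taking expectations in `X ≤ ρ Y` gives `τ Y ≤ ρ Y`, hence `τ ≤ ρ`, since `tr Y > 0`.
  have htrY : 0 < Y.trace := hY.trace_pos
  have hτρ : τ ≤ ρ := by
    have h1 : (τ • Y).trace ≤ (matrixExpectation X P).trace := by
      have := (Matrix.le_iff.1 hEX).trace_nonneg
      rwa [Matrix.trace_sub, sub_nonneg] at this
    have h2 : (matrixExpectation X P).trace ≤ (ρ • Y).trace := by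
      rw [trace_matrixExpectation hXint]
      calc ∫ ω, (X ω).trace ∂P ≤ ∫ _, (ρ • Y).trace ∂P := by
            refine integral_mono_ae (integrable_trace hXint) (integrable_const _) ?_
            filter_upwards [hXbd] with ω h
            have := (Matrix.le_iff.1 h.2).trace_nonneg
            rwa [Matrix.trace_sub, sub_nonneg] at this
        _ = (ρ • Y).trace := by simp
    have h3 := h1.trans h2
    simp only [Matrix.trace_smul, smul_eq_mul] at h3
    exact le_of_mul_le_mul_right h3 htrY
  have hρ0 : 0 < ρ := hτ.trans_le hτρ
  have hlog : 0 < Real.log (2 * n) := Real.log_pos (by linarith)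
  have hTr : 4 * ρ / (γ ^ 2 * τ) * Real.log (2 * n) ≤ T := by
    exact_mod_cast Int.ceil_le.1 hT
  have hT0 : (0 : ℝ) < T := lt_of_lt_of_le (by positivity) hTr
  -- Write `ρ Y = Cᴴ C` with `C` invertible; conjugation by `B = C⁻¹` normalises `ρ Y` to `1`.
  obtain ⟨C, hC, hρY⟩ := CStarAlgebra.isStrictlyPositive_iff_eq_star_mul_self.mp
    (hY.smul hρ0).isStrictlyPositive
  obtain ⟨B, hCB, hBC⟩ := isUnit_iff_exists.1 hC
  have hBC' : star C * star B = 1 := by rw [← star_mul, hBC, star_one]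
  have hCB' : star B * star C = 1 := by rw [← star_mul, hCB, star_one]
  have hnorm : star B * (ρ • Y) * B = 1 := by
    rw [hρY, ← mul_assoc, hCB', one_mul, hCB]
  have hnormY : star B * Y * B = ρ⁻¹ • 1 := by
    rw [← hnorm, Matrix.mul_smul, Matrix.smul_mul, smul_smul, inv_mul_cancel₀ hρ0.ne', one_smul]
  set Z : Fin T → Ω' → Matrix (Fin n) (Fin n) ℝ := fun t ω => star B * Xs t ω * B with hZdef
  have hφ : Measurable fun A : Matrix (Fin n) (Fin n) ℝ => star B * A * B :=
    ((continuous_const.matrix_mul continuous_id).matrix_mul continuous_const).measurable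
  have hXsbd (t) : ∀ᵐ ω ∂P', 0 ≤ Xs t ω ∧ Xs t ω ≤ ρ • Y :=
    (hident t).symm.ae_snd (measurableSet_matrix_Icc _) hXbd
  have hEXs (t) : matrixExpectation (Xs t) P' = matrixExpectation X P := by
    ext i j
    exact ((hident t).comp (measurable_matrix_entry i j)).integral_eq
  have hZ (t) : AEMeasurable (Z t) P' := hφ.comp_aemeasurable (hident t).aemeasurable_fst
  have hZb (t) : ∀ᵐ ω ∂P', 0 ≤ Z t ω ∧ Z t ω ≤ 1 := by
    filter_upwards [hXsbd t] with ω h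
    refine ⟨star_left_conjugate_nonneg h.1 B, ?_⟩
    rw [← hnorm]
    exact star_left_conjugate_le_conjugate h.2 B
  have hEZ (t) : (τ / ρ) • 1 ≤ matrixExpectation (Z t) P' := by
    rw [matrixExpectation_mul_mul
      (integrable_entry_of_nonneg_of_le (hident t).aemeasurable_fst (hXsbd t)), hEXs]
    have h := star_left_conjugate_le_conjugate hEX B
    rwa [Matrix.mul_smul, Matrix.smul_mul, hnormY, smul_smul, ← div_eq_mul_inv] at h
  have hindZ : iIndepFun Z P' := hindep.comp (fun _ A => star B * A * B) fun _ => hφ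
  have htail := measureReal_not_le_sum_le hγ0.le hγ1.le (by positivity)
    ((div_le_one hρ0).2 hτρ) hZ hZb hEZ hindZ
  rw [Fintype.card_fin] at htail
  -- The hypothesis on `T` makes the exponent at least `2 log (2n)`.
  have hsmall : n * Real.exp (-(T * (τ / ρ) * γ ^ 2 / 2)) ≤ 1 / (2 * n) := by
    have hexp : 2 * Real.log (2 * n) ≤ T * (τ / ρ) * γ ^ 2 / 2 := by
      calc 2 * Real.log (2 * n)
          = 4 * ρ / (γ ^ 2 * τ) * Real.log (2 * n) * (τ / ρ) * γ ^ 2 / 2 := by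
            field_simp; ring
        _ ≤ _ := by gcongr
    have hle : Real.exp (-(T * (τ / ρ) * γ ^ 2 / 2)) ≤ ((2 * (n : ℝ)) ^ 2)⁻¹ := by
      rw [Real.exp_neg]
      refine inv_anti₀ (by positivity) ?_
      rw [← Real.exp_log (by positivity : (0 : ℝ) < (2 * n) ^ 2), Real.log_pow]
      exact Real.exp_le_exp.2 (by exact_mod_cast hexp)
    calc n * Real.exp (-(T * (τ / ρ) * γ ^ 2 / 2)) ≤ n * ((2 * (n : ℝ)) ^ 2)⁻¹ := by gcongr
      _ ≤ 1 / (2 * n) := by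
        field_simp
        norm_num
  -- Conjugating back by `C` turns the normalised lower bound into the required one.
  have hback (ω) (h : ((1 - γ) * (τ / ρ) * T) • 1 ≤ ∑ t, Z t ω) :
      ((1 - γ) * τ) • Y ≤ (1 / (T : ℝ)) • ∑ t, Xs t ω := by
    have hsum : star C * (∑ t, Z t ω) * C = ∑ t, Xs t ω := by
      simp only [hZdef]
      rw [← Finset.sum_mul, ← Finset.mul_sum, ← mul_assoc, ← mul_assoc, hBC', one_mul, mul_assoc,
        hBC, mul_one]
    have h1 := star_left_conjugate_le_conjugate h C
    rw [hsum, Matrix.mul_smul, Matrix.smul_mul, mul_one, ← hρY, smul_smul] at h1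
    have h2 := smul_le_smul_of_nonneg_left h1 (by positivity : 0 ≤ 1 / (T : ℝ))
    rw [smul_smul] at h2
    convert h2 using 2
    field_simp
  -- Only subadditivity of `P'` is used, so the event need not be measurable.
  have hcover : (1 : ℝ) ≤ P'.real {ω | ((1 - γ) * τ) • Y ≤ (1 / (T : ℝ)) • ∑ t, Xs t ω}
      + P'.real {ω | ¬ ((1 - γ) * (τ / ρ) * T) • 1 ≤ ∑ t, Z t ω} := by
    refine (probReal_univ (μ := P')).symm.le.trans ?_
    refine (measureReal_mono fun ω _ => ?_).trans (measureReal_union_le _ _)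
    by_cases h : ((1 - γ) * (τ / ρ) * T) • 1 ≤ ∑ t, Z t ω
    · exact Or.inl (hback ω h)
    · exact Or.inr h
  linarith
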